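/- Let $f$ be a polynomial with complex coefficients of degree $d\ge 2$ which is monic and centered, i.e. $f(z)=z^d+c_{d-2}z^{d-2}+\dots+c_0$, and let $f^n$ ($n\ge 1$) denote its $n$-th iterate. Let $\varphi^{-1}(z)=az+b$ with $a\in\mathbb{C}\setminus\{0\}$ and $b\in\mathbb{C}$. For a polynomial $p$ of degree at least $2$ let $K_p$ be its filled Julia set (the set of points with bounded forward orbit under $p$) and $J_p=\partial K_p$ its Julia set. For a sequence $(S_n)_{n\ge1}$ of subsets of $\mathbb{C}$ let $\liminf_n S_n$ be the set of limits of convergent sequences $(z_n)_{n\ge1}$ with $z_n\in S_n$ for all $n$, and let $\limsup_n S_n$ be the set of limits of convergent sequences $(z_{n_k})_k$ with $z_{n_k}\in S_{n_k}$ for some strictly increasing sequence $(n_k)_k$ of indices. Then $$J_f\subseteq\liminf_{n\to\infty}J_{\varphi^{-1}\circ f^n}\subseteq\limsup_{n\to\infty}K_{\varphi^{-1}\circ f^n}\subseteq K_f .$$ In particular, if $J_f=K_f$, then $\lim_{n\to\infty}J_{\varphi^{-1}\circ f^n}=J_f$, that is, $\liminf_{n}J_{\varphi^{-1}\circ f^n}=\limsup_{n}J_{\varphi^{-1}\circ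 f^n}=J_f$, and the sets $J_{\varphi^{-1}\circ f^n}$ ($n\ge1$) converge to $J_f$ in the Hausdorff distance on the space of non-empty compact subsets of $\mathbb{C}$. -/

import Mathlib

open Polynomial Filter Topology

/-- The filled Julia set of a complex polynomial (of degree at least two): the set of points
whose forward orbit is bounded. -/
def filledJuliaSet (p : ℂ[X]) : Set ℂ :=
  {z | Bornology.IsBounded (Set.range fun n : ℕ => (fun w : ℂ => p.eval w)^[n] z)}

/-- The Julia set of a complex polynomial (of degree at least two): the boundary of its filled
Julia set, equivalently of its basin of attraction of infinity. -/
def juliaSet (p : ℂ[X]) : Set ℂ :=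
  frontier (filledJuliaSet p)

/-- The lower limit of a sequence `S 1, S 2, S 3, …` of subsets of the plane (the value `S 0` is
ignored): all limits of convergent sequences `z 1, z 2, …` with `z n ∈ S n`. -/
def setLiminf (S : ℕ → Set ℂ) : Set ℂ :=
  {x | ∃ z : ℕ → ℂ, (∀ n, 1 ≤ n → z n ∈ S n) ∧ Tendsto z atTop (𝓝 x)}

/-- The upper limit of a sequence `S 1, S 2, S 3, …` of subsets of the plane (the value `S 0` is
ignored): all limits of sequences of points of `S` along a strictly increasing sequence of
indices. -/
def setLimsup (S : ℕ → Set ℂ) : Set ℂ :=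
  {x | ∃ n : ℕ → ℕ, StrictMono n ∧ (∀ k, 1 ≤ n k) ∧
    ∃ z : ℕ → ℂ, (∀ k, z k ∈ S (n k)) ∧ Tendsto z atTop (𝓝 x)}

/-- Convergence of `S 1, S 2, S 3, …` to `L` in the space of non-empty compact subsets of the
plane, equipped with the Hausdorff distance. -/
def TendstoHausdorff (S : ℕ → Set ℂ) (L : Set ℂ) : Prop :=
  (∀ n, 1 ≤ n → (S n).Nonempty ∧ IsCompact (S n)) ∧ L.Nonempty ∧ IsCompact L ∧
    Tendsto (fun n => Metric.hausdorffEDist (S n) L) atTop (𝓝 0)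

/-- The polynomial `a * f^n(z) + b`, where `f^n` is the `n`-th iterate of `f` under composition. -/
noncomputable def affineIterate (a b : ℂ) (f : ℂ[X]) (n : ℕ) : ℂ[X] :=
  (C a * X + C b).comp (f.comp^[n] X)

/-!
If `J_f` missed the Julia sets of infinitely many `P n = a * f^n + b` near a point `x`, then near
`x` there would be points `y` with `f^n y → ∞` and a disk around `x` containing `y` on which all
large iterates of such a `P n` are large. There `log ‖P n^[k]‖` is a positive harmonic function, so
Harnack's inequality compares its values at `x` and `y`. Dividing by `(deg P n) ^ k` bounds
`‖P n y‖` by a power of `‖P n x‖`, with constants independent of `n` and `k`; but `P n x` stays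
bounded while `P n y → ∞`. The other inclusions only use that the `P n` share an escape radius.
-/

open Bornology InnerProductSpace Metric Set

theorem eventually_forall_mem_of_isCompact {ι α : Type*} [TopologicalSpace α] {l : Filter ι}
    {K : Set α} (hK : IsCompact K) {Q : ι → α → Prop}
    (hQ : ∀ x ∈ K, ∀ᶠ q : ι × α in l ×ˢ 𝓝 x, Q q.1 q.2) : ∀ᶠ n in l, ∀ x ∈ K, Q n x := by
  have h : ∀ᶠ q : ι × α in l ×ˢ 𝓝ˢ K, Q q.1 q.2 := hK.mem_prod_nhdsSet_of_forall hQ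
  exact h.curry.mono fun _ h => h.self_of_nhdsSet

section Harnack

theorem harnack_le_mul_center {u : ℂ → ℝ} {c w : ℂ} {R : ℝ}
    (hu : HarmonicContOnCl u (ball c R)) (hnonneg : ∀ z ∈ sphere c R, 0 ≤ u z)
    (hw : w ∈ ball c R) : u w ≤ (R + ‖w - c‖) / (R - ‖w - c‖) * u c := by
  have hR : |R| = R := abs_of_pos (pos_of_mem_ball hw)
  have hcont : ContinuousOn u (sphere c |R|) := by
    rw [hR]
    exact hu.continuousOn_ball.mono sphere_subset_closedBall
  have hkernel : ContinuousOn (Complex.re ∘ herglotzRieszKernel c w) (sphere c |R|) :=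
    Complex.continuous_re.comp_continuousOn (continuousOn_herglotzRieszKernel_sphere hw)
  calc u w = Real.circleAverage ((Complex.re ∘ herglotzRieszKernel c w) • u) c R :=
        (hu.circleAverage_re_herglotzRieszKernel_smul hw).symm
    _ ≤ Real.circleAverage (((R + ‖w - c‖) / (R - ‖w - c‖)) • u) c R := by
        refine Real.circleAverage_mono (hkernel.smul hcont).circleIntegrable'
          (hcont.const_smul _).circleIntegrable' fun z hz => ?_
        rw [hR] at hz
        exact mul_le_mul_of_nonneg_right (re_herglotzRieszKernel_le hz hw) (hnonneg z hz)
    _ = (R + ‖w - c‖) / (R - ‖w - c‖) * u c := by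
        rw [Real.circleAverage_smul, smul_eq_mul,
          InnerProductSpace.HarmonicContOnCl.circleAverage_eq (hR.symm ▸ hu)]

theorem norm_le_norm_center_pow_three {F : ℂ → ℂ} {c w : ℂ} {R : ℝ} (hR : 0 < R)
    (hF : AnalyticOnNhd ℂ F (closedBall c R)) (hone : ∀ z ∈ closedBall c R, 1 ≤ ‖F z‖)
    (hw : dist w c ≤ R / 2) : ‖F w‖ ≤ ‖F c‖ ^ 3 := by
  have hpos : ∀ z ∈ closedBall c R, 0 < ‖F z‖ := fun z hz => one_pos.trans_le (hone z hz)
  have hharm : HarmonicOnNhd (fun z => Real.log ‖F z‖) (closedBall c R) := fun z hz =>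
    (hF z hz).harmonicAt_log_norm (norm_pos_iff.1 (hpos z hz))
  have hwR : w ∈ ball c R := mem_ball.2 (by linarith)
  have hlog_nonneg : ∀ z ∈ closedBall c R, 0 ≤ Real.log ‖F z‖ := fun z hz =>
    Real.log_nonneg (hone z hz)
  have hc : c ∈ closedBall c R := mem_closedBall_self hR.le
  have hratio : (R + ‖w - c‖) / (R - ‖w - c‖) ≤ 3 := by
    rw [← dist_eq_norm, div_le_iff₀ (by linarith)]
    linarith
  rw [← Real.log_le_log_iff (hpos w (ball_subset_closedBall hwR)) (pow_pos (hpos c hc) 3),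
    Real.log_pow]
  calc Real.log ‖F w‖ ≤ (R + ‖w - c‖) / (R - ‖w - c‖) * Real.log ‖F c‖ :=
        harnack_le_mul_center
          (HarmonicOnNhd.harmonicContOnCl (hharm.mono closure_ball_subset_closedBall))
          (fun z hz => hlog_nonneg z (sphere_subset_closedBall hz)) hwR
    _ ≤ 3 * Real.log ‖F c‖ := mul_le_mul_of_nonneg_right hratio (hlog_nonneg c hc)

end Harnack

/-- A scale `s` at which `g` grows at least like `z ^ D` outside the disk of radius `2 / s`. For a
polynomial of degree `D` it encodes the lower bound `log (s * ‖z‖)` for its Green's function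
there, and `2 / s` is an escape radius. -/
structure IsEscapeScale {E : Type*} [Norm E] (g : E → E) (D : ℕ) (s : ℝ) : Prop where
  two_le : 2 ≤ D
  pos : 0 < s
  le_one : s ≤ 1
  pow_le : ∀ z, 2 ≤ s * ‖z‖ → (s * ‖z‖) ^ D ≤ s * ‖g z‖

/-- A scale `S` at which `g` grows at most like `z ^ D`. For a polynomial of degree `D` it encodes
the upper bound `log (S * max 1 ‖z‖)` for its Green's function. -/
structure IsGrowthScale {E : Type*} [Norm E] (g : E → E) (D : ℕ) (S : ℝ) : Prop where
  one_le : 1 ≤ S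
  le_pow : ∀ z, S * max 1 ‖g z‖ ≤ (S * max 1 ‖z‖) ^ D

section Scales

variable {E : Type*} [Norm E] {g : E → E} {D : ℕ} {s S : ℝ} {z : E}

theorem IsEscapeScale.pow_le_iterate (hs : IsEscapeScale g D s) (hz : 2 ≤ s * ‖z‖) (n : ℕ) :
    (s * ‖z‖) ^ D ^ n ≤ s * ‖g^[n] z‖ := by
  induction n with
  | zero => simp
  | succ n ih =>
    have hfar : 2 ≤ s * ‖g^[n] z‖ :=
      (hz.trans (le_self_pow₀ (by linarith) (pow_ne_zero n (by have := hs.two_le; omega)))).trans ih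
    rw [Function.iterate_succ_apply', pow_succ, pow_mul]
    exact (pow_le_pow_left₀ (by positivity) ih D).trans (hs.pow_le _ hfar)

theorem IsEscapeScale.two_pow_le_norm_iterate (hs : IsEscapeScale g D s) (hz : 2 ≤ s * ‖z‖)
    (n : ℕ) : 2 ^ n ≤ s * ‖g^[n] z‖ :=
  calc (2 : ℝ) ^ n ≤ 2 ^ D ^ n :=
        pow_le_pow_right₀ one_le_two (Nat.lt_pow_self (one_lt_two.trans_le hs.two_le)).le
    _ ≤ (s * ‖z‖) ^ D ^ n := pow_le_pow_left₀ zero_le_two hz _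
    _ ≤ s * ‖g^[n] z‖ := hs.pow_le_iterate hz n

theorem IsGrowthScale.iterate_le_pow (hS : IsGrowthScale g D S) (z : E) (n : ℕ) :
    S * max 1 ‖g^[n] z‖ ≤ (S * max 1 ‖z‖) ^ D ^ n := by
  induction n with
  | zero => simp
  | succ n ih =>
    have := hS.one_le
    rw [Function.iterate_succ_apply', pow_succ, pow_mul]
    exact (hS.le_pow _).trans (pow_le_pow_left₀ (by positivity) ih D)

end Scales

section PolynomialScales

variable {𝕜 : Type*} [NormedField 𝕜] {p : 𝕜[X]}

theorem eventually_cobounded_mul_pow_le_norm_eval (hp : p ≠ 0) :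
    ∃ κ > 0, ∀ᶠ z in cobounded 𝕜, κ * ‖z‖ ^ p.natDegree ≤ ‖p.eval z‖ := by
  have hlead : 0 < ‖p.leadingCoeff‖ := norm_pos_iff.2 (leadingCoeff_ne_zero.2 hp)
  have hlim : Tendsto (fun z => ‖p.reverse.eval z⁻¹‖) (cobounded 𝕜) (𝓝 ‖p.leadingCoeff‖) := by
    have h := (p.reverse.continuous.tendsto 0).norm.comp (tendsto_inv₀_cobounded (α := 𝕜))
    rwa [← coeff_zero_eq_eval_zero, coeff_zero_reverse] at h
  refine ⟨‖p.leadingCoeff‖ / 2, half_pos hlead, ?_⟩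
  filter_upwards [hlim.eventually_const_le (half_lt_self hlead), eventually_ne_cobounded 0]
    with z hz hz0
  let _ := invertibleOfNonzero hz0
  have hreverse : p.reverse.eval z⁻¹ * z ^ p.natDegree = p.eval z := by
    simpa [eval₂_eq_eval_map] using eval₂_reverse_mul_pow (RingHom.id 𝕜) z p
  rw [← hreverse, norm_mul, norm_pow]
  gcongr

theorem exists_isEscapeScale_eval (hp : 2 ≤ p.natDegree) :
    ∃ s, IsEscapeScale (p.eval ·) p.natDegree s := by
  obtain ⟨κ, hκ, hlarge⟩ := eventually_cobounded_mul_pow_le_norm_eval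
    (ne_zero_of_natDegree_gt (n := 1) hp)
  obtain ⟨R, -, hR⟩ := hasBasis_cobounded_norm.eventually_iff.1 hlarge
  obtain ⟨s, hs, hs1, hsκ, hsR⟩ : ∃ s : ℝ, 0 < s ∧ s ≤ 1 ∧ s ≤ κ ∧ s * |R| ≤ 2 := by
    refine ⟨min (min 1 κ) (2 / (|R| + 1)), by positivity, (min_le_left _ _).trans (min_le_left _ _),
      (min_le_left _ _).trans (min_le_right _ _), ?_⟩
    calc _ ≤ 2 / (|R| + 1) * (|R| + 1) := by gcongr; exacts [min_le_right _ _, by linarith]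
      _ = 2 := by field_simp
  refine ⟨s, hp, hs, hs1, fun z hz => ?_⟩
  have hRz : R ≤ ‖z‖ := (le_abs_self R).trans (le_of_mul_le_mul_left (hsR.trans hz) hs)
  calc (s * ‖z‖) ^ p.natDegree = s ^ p.natDegree * ‖z‖ ^ p.natDegree := mul_pow _ _ _
    _ ≤ s ^ 2 * ‖z‖ ^ p.natDegree := by gcongr ?_ * _; exact pow_le_pow_of_le_one hs.le hs1 hp
    _ = s * (s * ‖z‖ ^ p.natDegree) := by ring
    _ ≤ s * ‖p.eval z‖ := by
        gcongr
        exact (mul_le_mul_of_nonneg_right hsκ (by positivity)).trans (hR hRz)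

theorem norm_eval_le_sum_norm_coeff_mul_pow (p : 𝕜[X]) (z : 𝕜) :
    ‖p.eval z‖ ≤
      (∑ i ∈ Finset.range (p.natDegree + 1), ‖p.coeff i‖) * max 1 ‖z‖ ^ p.natDegree := by
  rw [eval_eq_sum_range, Finset.sum_mul]
  refine norm_sum_le_of_le _ fun i hi => ?_
  rw [norm_mul, norm_pow]
  gcongr
  calc ‖z‖ ^ i ≤ max 1 ‖z‖ ^ i := by gcongr; exact le_max_right _ _
    _ ≤ max 1 ‖z‖ ^ p.natDegree :=
        pow_le_pow_right₀ (le_max_left _ _) (Finset.mem_range_succ_iff.1 hi)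

theorem exists_isGrowthScale_eval (hp : 2 ≤ p.natDegree) :
    ∃ S, IsGrowthScale (p.eval ·) p.natDegree S := by
  set S := max 1 (∑ i ∈ Finset.range (p.natDegree + 1), ‖p.coeff i‖)
  have hS1 : 1 ≤ S := le_max_left _ _
  refine ⟨S, hS1, fun z => ?_⟩
  have hm : 1 ≤ max 1 ‖z‖ := le_max_left _ _
  have heval : max 1 ‖p.eval z‖ ≤ S * max 1 ‖z‖ ^ p.natDegree := by
    refine max_le (one_le_mul_of_one_le_of_one_le hS1 (one_le_pow₀ hm)) ?_
    exact (norm_eval_le_sum_norm_coeff_mul_pow p z).trans (by gcongr; exact le_max_right _ _)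
  calc S * max 1 ‖p.eval z‖ ≤ S * (S * max 1 ‖z‖ ^ p.natDegree) := by gcongr
    _ = S ^ 2 * max 1 ‖z‖ ^ p.natDegree := by ring
    _ ≤ S ^ p.natDegree * max 1 ‖z‖ ^ p.natDegree := by gcongr
    _ = (S * max 1 ‖z‖) ^ p.natDegree := (mul_pow _ _ _).symm

end PolynomialScales

section JuliaSet

variable {p : ℂ[X]} {D : ℕ} {s S : ℝ} {x y z : ℂ}

theorem mem_filledJuliaSet_iff_isBounded :
    z ∈ filledJuliaSet p ↔ IsBounded (range fun n : ℕ => (p.eval ·)^[n] z) :=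
  Iff.rfl

theorem eval_mem_filledJuliaSet_iff : p.eval z ∈ filledJuliaSet p ↔ z ∈ filledJuliaSet p := by
  rw [mem_filledJuliaSet_iff_isBounded, mem_filledJuliaSet_iff_isBounded]
  refine ⟨fun h => (h.insert z).subset ?_, fun h => h.subset ?_⟩
  · rintro _ ⟨_ | n, rfl⟩
    exacts [mem_insert _ _, mem_insert_of_mem _ ⟨n, rfl⟩]
  · rintro _ ⟨n, rfl⟩
    exact ⟨n + 1, rfl⟩

theorem iterate_eval_mem_filledJuliaSet_iff (n : ℕ) :
    (p.eval ·)^[n] z ∈ filledJuliaSet p ↔ z ∈ filledJuliaSet p := by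
  induction n with
  | zero => rfl
  | succ n ih => rw [Function.iterate_succ_apply', eval_mem_filledJuliaSet_iff, ih]

theorem IsEscapeScale.notMem_filledJuliaSet (hs : IsEscapeScale (p.eval ·) D s)
    (hz : 2 ≤ s * ‖z‖) : z ∉ filledJuliaSet p := by
  intro hmem
  obtain ⟨B, hB⟩ := isBounded_iff_forall_norm_le.1 (mem_filledJuliaSet_iff_isBounded.1 hmem)
  obtain ⟨n, hn⟩ := pow_unbounded_of_one_lt (s * B) (one_lt_two (α := ℝ))
  have hle : s * ‖(p.eval ·)^[n] z‖ ≤ s * B :=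
    mul_le_mul_of_nonneg_left (hB _ ⟨n, rfl⟩) hs.pos.le
  exact (hn.trans_le (hs.two_pow_le_norm_iterate hz n)).not_ge hle

theorem IsEscapeScale.filledJuliaSet_subset_closedBall (hs : IsEscapeScale (p.eval ·) D s) :
    filledJuliaSet p ⊆ closedBall 0 (2 / s) := by
  intro z hz
  rw [mem_closedBall_zero_iff, le_div_iff₀' hs.pos]
  exact (not_le.1 fun h => hs.notMem_filledJuliaSet h hz).le

theorem IsEscapeScale.mem_filledJuliaSet_iff (hs : IsEscapeScale (p.eval ·) D s) :
    z ∈ filledJuliaSet p ↔ ∀ n : ℕ, s * ‖(p.eval ·)^[n] z‖ ≤ 2 := by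
  constructor
  · intro hz n
    exact (not_le.1 fun h =>
      hs.notMem_filledJuliaSet h ((iterate_eval_mem_filledJuliaSet_iff n).2 hz)).le
  · refine fun hz => mem_filledJuliaSet_iff_isBounded.2
      (isBounded_iff_forall_norm_le.2 ⟨2 / s, ?_⟩)
    rintro _ ⟨n, rfl⟩
    exact (le_div_iff₀' hs.pos).2 (hz n)

theorem IsEscapeScale.isCompact_filledJuliaSet (hs : IsEscapeScale (p.eval ·) D s) :
    IsCompact (filledJuliaSet p) := by
  refine (isCompact_closedBall 0 _).of_isClosed_subset ?_ hs.filledJuliaSet_subset_closedBall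
  have hinter : filledJuliaSet p = ⋂ n : ℕ, {z | s * ‖(p.eval ·)^[n] z‖ ≤ 2} := by
    ext z
    simp only [hs.mem_filledJuliaSet_iff, mem_iInter, mem_ofPred_eq]
  rw [hinter]
  exact isClosed_iInter fun n =>
    isClosed_le (continuous_const.mul (p.continuous.iterate n).norm) continuous_const

theorem isCompact_filledJuliaSet (hp : 2 ≤ p.natDegree) : IsCompact (filledJuliaSet p) :=
  (exists_isEscapeScale_eval hp).elim fun _ hs => hs.isCompact_filledJuliaSet

theorem filledJuliaSet_nonempty (hp : 2 ≤ p.natDegree) : (filledJuliaSet p).Nonempty := by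
  have hdeg : (p - X).natDegree = p.natDegree :=
    natDegree_sub_eq_left_of_natDegree_lt (by rw [natDegree_X]; omega)
  obtain ⟨z, hz⟩ := IsAlgClosed.exists_root (p - X)
    (degree_ne_of_natDegree_ne (n := 0) (by omega))
  have hfixed : p.eval z = z := by simpa [IsRoot, sub_eq_zero] using hz
  refine ⟨z, mem_filledJuliaSet_iff_isBounded.2 ((isBounded_singleton (x := z)).subset ?_)⟩
  rintro _ ⟨n, rfl⟩
  exact Function.iterate_fixed hfixed n

theorem juliaSet_subset_filledJuliaSet (hp : 2 ≤ p.natDegree) : juliaSet p ⊆ filledJuliaSet p :=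
  (isCompact_filledJuliaSet hp).isClosed.frontier_subset

theorem isCompact_juliaSet (hp : 2 ≤ p.natDegree) : IsCompact (juliaSet p) :=
  (isCompact_filledJuliaSet hp).of_isClosed_subset isClosed_frontier
    (juliaSet_subset_filledJuliaSet hp)

theorem juliaSet_nonempty (hp : 2 ≤ p.natDegree) : (juliaSet p).Nonempty :=
  nonempty_frontier_iff.2 ⟨filledJuliaSet_nonempty hp, (isCompact_filledJuliaSet hp).ne_univ⟩

theorem IsEscapeScale.tendsto_iterate_cobounded (hs : IsEscapeScale (p.eval ·) D s)
    (hx : x ∉ filledJuliaSet p) :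
    Tendsto (fun q : ℕ × ℂ => (p.eval ·)^[q.1] q.2) (atTop ×ˢ 𝓝 x) (cobounded ℂ) := by
  obtain ⟨m, hm⟩ : ∃ m : ℕ, 2 < s * ‖(p.eval ·)^[m] x‖ := by
    simpa only [hs.mem_filledJuliaSet_iff, not_forall, not_le] using hx
  have hnear : ∀ᶠ z in 𝓝 x, 2 < s * ‖(p.eval ·)^[m] z‖ :=
    (continuous_const.mul (p.continuous.iterate m).norm).continuousAt.eventually_const_lt hm
  have hpow : Tendsto (fun q : ℕ × ℂ => (2 : ℝ) ^ (q.1 - m)) (atTop ×ˢ 𝓝 x) atTop :=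
    ((tendsto_pow_atTop_atTop_of_one_lt one_lt_two).comp (tendsto_sub_atTop_nat m)).comp
      tendsto_fst
  refine tendsto_norm_atTop_iff_cobounded.1 (tendsto_atTop_mono' _ ?_ hpow)
  filter_upwards [(eventually_ge_atTop m).prod_mk hnear] with ⟨n, z⟩ ⟨hmn, hz⟩
  calc (2 : ℝ) ^ (n - m) ≤ s * ‖(p.eval ·)^[n - m] ((p.eval ·)^[m] z)‖ :=
        hs.two_pow_le_norm_iterate hz.le _
    _ = s * ‖(p.eval ·)^[n] z‖ := by rw [← Function.iterate_add_apply, Nat.sub_add_cancel hmn]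
    _ ≤ ‖(p.eval ·)^[n] z‖ := mul_le_of_le_one_left (norm_nonneg _) hs.le_one

theorem IsEscapeScale.mul_norm_eval_le_pow_three (hs : IsEscapeScale (p.eval ·) D s)
    (hS : IsGrowthScale (p.eval ·) D S) {r : ℝ} (hr : 0 < r)
    (hescape : closedBall x r ⊆ (filledJuliaSet p)ᶜ) (hyx : dist y x ≤ r / 2)
    (hfar : 2 ≤ s * ‖p.eval y‖) : s * ‖p.eval y‖ ≤ (S * max 1 ‖p.eval x‖) ^ 3 := by
  have hs0 := hs.pos
  have hS1 := hS.one_le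
  have hlarge : ∀ᶠ n in atTop, ∀ z ∈ closedBall x r, 1 / s ≤ ‖(p.eval ·)^[n] z‖ :=
    eventually_forall_mem_of_isCompact (isCompact_closedBall x r) fun z hz =>
      (tendsto_norm_atTop_iff_cobounded.2
        (hs.tendsto_iterate_cobounded (hescape hz))).eventually_ge_atTop _
  obtain ⟨k, hk⟩ := ((tendsto_add_atTop_nat 1).eventually hlarge).exists
  set F : ℂ → ℂ := fun z => s * (p.eval ·)^[k + 1] z
  have hF : Differentiable ℂ F := (p.differentiable.iterate (k + 1)).const_mul _
  have hnorm : ∀ z, ‖F z‖ = s * ‖(p.eval ·)^[k + 1] z‖ := fun z => by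
    rw [norm_mul, Complex.norm_of_nonneg hs0.le]
  have hone : ∀ z ∈ closedBall x r, 1 ≤ ‖F z‖ := fun z hz => by
    rw [hnorm]
    exact (div_le_iff₀' hs0).1 (hk z hz)
  refine (pow_le_pow_iff_left₀ (by positivity) (by positivity)
    (pow_ne_zero k (two_pos.trans_le hs.two_le).ne')).1 ?_
  calc (s * ‖p.eval y‖) ^ D ^ k ≤ ‖F y‖ := hnorm y ▸ hs.pow_le_iterate hfar k
    _ ≤ ‖F x‖ ^ 3 := norm_le_norm_center_pow_three hr (fun z _ => hF.analyticAt z) hone hyx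
    _ ≤ (S * max 1 ‖(p.eval ·)^[k + 1] x‖) ^ 3 := by
        rw [hnorm]
        gcongr
        exacts [hs.le_one.trans hS1, le_max_right _ _]
    _ ≤ ((S * max 1 ‖p.eval x‖) ^ D ^ k) ^ 3 := by gcongr; exact hS.iterate_le_pow _ k
    _ = ((S * max 1 ‖p.eval x‖) ^ 3) ^ D ^ k := pow_right_comm _ _ _

theorem inter_frontier_nonempty_of_isPreconnected {α : Type*} [TopologicalSpace α] {t K : Set α}
    (ht : IsPreconnected t) (hK : IsClosed K) (hmeet : (t ∩ K).Nonempty) (hout : (t \ K).Nonempty) :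
    (t ∩ frontier K).Nonempty := by
  by_contra hempty
  have hsub : t ⊆ Kᶜ := ht.subset_of_closure_inter_subset hK.isOpen_compl hout fun z hz hzK =>
    hempty ⟨z, hz.2, frontier_eq_closure_inter_closure (s := K) ▸ ⟨subset_closure hzK, hz.1⟩⟩
  obtain ⟨z, hzt, hzK⟩ := hmeet
  exact hsub hzt hzK

theorem eventually_ball_inter_juliaSet_nonempty {ι : Type*} {l : Filter ι} {P : ι → ℂ[X]}
    {D : ι → ℕ} {C ε : ℝ} (hs : ∀ᶠ n in l, IsEscapeScale ((P n).eval ·) (D n) s)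
    (hS : ∀ᶠ n in l, IsGrowthScale ((P n).eval ·) (D n) S)
    (hbdd : ∀ᶠ n in l, ‖(P n).eval x‖ ≤ C)
    (hunbdd : ∃ᶠ y in 𝓝 x, Tendsto (fun n => ‖(P n).eval y‖) l atTop) (hε : 0 < ε) :
    ∀ᶠ n in l, (ball x ε ∩ juliaSet (P n)).Nonempty := by
  obtain ⟨y, hy, hyx : dist y x < ε / 4⟩ :=
    (hunbdd.and_eventually (ball_mem_nhds x (by positivity : 0 < ε / 4))).exists
  filter_upwards [hs, hS, hbdd, hy.eventually_ge_atTop (2 / s),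
    hy.eventually_gt_atTop ((S * max 1 C) ^ 3 / s)] with n hs hS hx hy2 hylarge
  have hS1 := hS.one_le
  have hfar : 2 ≤ s * ‖(P n).eval y‖ := (div_le_iff₀' hs.pos).1 hy2
  have hyK : y ∉ filledJuliaSet (P n) := fun h =>
    hs.notMem_filledJuliaSet hfar (eval_mem_filledJuliaSet_iff.2 h)
  refine inter_frontier_nonempty_of_isPreconnected (convex_ball x ε).isPreconnected
    hs.isCompact_filledJuliaSet.isClosed ?_ ⟨y, mem_ball.2 (by linarith), hyK⟩
  by_contra hempty
  refine ((div_lt_iff₀' hs.pos).1 hylarge).not_ge ?_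
  calc s * ‖(P n).eval y‖ ≤ (S * max 1 ‖(P n).eval x‖) ^ 3 :=
        hs.mul_norm_eval_le_pow_three hS (half_pos hε)
          (fun z hz hzK => hempty ⟨z, closedBall_subset_ball (half_lt_self hε) hz, hzK⟩)
          (by linarith) hfar
    _ ≤ (S * max 1 C) ^ 3 := by gcongr

end JuliaSet

section AffineIterate

variable {a b : ℂ} {f : ℂ[X]} {d n : ℕ} {s S : ℝ} {x : ℂ}

theorem eval_affineIterate (a b : ℂ) (f : ℂ[X]) (n : ℕ) (z : ℂ) :
    (affineIterate a b f n).eval z = a * (f.eval ·)^[n] z + b := by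
  simp [affineIterate]

theorem natDegree_affineIterate (ha : a ≠ 0) (b : ℂ) (f : ℂ[X]) (n : ℕ) :
    (affineIterate a b f n).natDegree = f.natDegree ^ n := by
  rw [affineIterate, natDegree_comp, natDegree_linear ha, one_mul, natDegree_iterate_comp,
    natDegree_X, mul_one]

theorem two_le_natDegree_affineIterate (ha : a ≠ 0) (b : ℂ) (hf : 2 ≤ f.natDegree) (hn : n ≠ 0) :
    2 ≤ (affineIterate a b f n).natDegree := by
  rw [natDegree_affineIterate ha]
  exact hf.trans (Nat.le_self_pow hn _)

theorem IsEscapeScale.eventually_affineIterate_eval (hs : IsEscapeScale (f.eval ·) d s) (ha : a ≠ 0)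
    (b : ℂ) :
    ∀ᶠ n in atTop, IsEscapeScale ((affineIterate a b f n).eval ·) (d ^ n) (s / 2) := by
  have hs0 := hs.pos
  have ha0 : 0 < ‖a‖ / 2 := half_pos (norm_pos_iff.2 ha)
  have hpow : Tendsto (fun n => ‖a‖ / 2 * 2 ^ d ^ n) atTop atTop :=
    ((tendsto_pow_atTop_atTop_of_one_lt one_lt_two).comp
      (tendsto_pow_atTop_atTop_of_one_lt (one_lt_two.trans_le hs.two_le))).const_mul_atTop ha0
  filter_upwards [eventually_ne_atTop 0, hpow.eventually_ge_atTop (1 + s / 2 * ‖b‖)]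
    with n hn hlarge
  refine ⟨hs.two_le.trans (Nat.le_self_pow hn d), half_pos hs0, by linarith [hs.le_one],
    fun z hz => ?_⟩
  have ht : 1 ≤ (s / 2 * ‖z‖) ^ d ^ n := one_le_pow₀ (one_le_two.trans hz)
  have hiterate : (2 * (s / 2 * ‖z‖)) ^ d ^ n ≤ s * ‖(f.eval ·)^[n] z‖ := by
    convert hs.pow_le_iterate (z := z) (by linarith) n using 2
    ring
  calc (s / 2 * ‖z‖) ^ d ^ n
      ≤ (s / 2 * ‖z‖) ^ d ^ n + s / 2 * ‖b‖ * ((s / 2 * ‖z‖) ^ d ^ n - 1) :=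
        le_add_of_nonneg_right (mul_nonneg (by positivity) (sub_nonneg.2 ht))
    _ = (1 + s / 2 * ‖b‖) * (s / 2 * ‖z‖) ^ d ^ n - s / 2 * ‖b‖ := by ring
    _ ≤ ‖a‖ / 2 * 2 ^ d ^ n * (s / 2 * ‖z‖) ^ d ^ n - s / 2 * ‖b‖ := by gcongr
    _ = ‖a‖ / 2 * (2 * (s / 2 * ‖z‖)) ^ d ^ n - s / 2 * ‖b‖ := by rw [mul_pow 2, mul_assoc]
    _ ≤ ‖a‖ / 2 * (s * ‖(f.eval ·)^[n] z‖) - s / 2 * ‖b‖ := by gcongr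
    _ = s / 2 * (‖a * (f.eval ·)^[n] z‖ - ‖b‖) := by rw [norm_mul]; ring
    _ ≤ s / 2 * ‖(affineIterate a b f n).eval z‖ := by
        rw [eval_affineIterate]
        gcongr
        simpa using norm_sub_norm_le (a * (f.eval ·)^[n] z) (-b)

theorem IsGrowthScale.affineIterate_eval (hS : IsGrowthScale (f.eval ·) d S) (hd : 2 ≤ d)
    (hn : n ≠ 0) (a b : ℂ) :
    IsGrowthScale ((affineIterate a b f n).eval ·) (d ^ n) (max 1 (‖a‖ + ‖b‖) * S) := by
  set A := max 1 (‖a‖ + ‖b‖)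
  have hA : 1 ≤ A := le_max_left _ _
  have hS1 := hS.one_le
  refine ⟨one_le_mul_of_one_le_of_one_le hA hS1, fun z => ?_⟩
  set w := (f.eval ·)^[n] z
  have hw : 1 ≤ max 1 ‖w‖ := le_max_left _ _
  have heval : max 1 ‖(affineIterate a b f n).eval z‖ ≤ A * max 1 ‖w‖ := by
    rw [eval_affineIterate]
    refine max_le (one_le_mul_of_one_le_of_one_le hA hw) ?_
    calc ‖a * w + b‖ ≤ ‖a‖ * ‖w‖ + ‖b‖ := norm_mul a w ▸ norm_add_le _ _
      _ ≤ ‖a‖ * max 1 ‖w‖ + ‖b‖ * max 1 ‖w‖ := by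
          gcongr
          exacts [le_max_right _ _, le_mul_of_one_le_right (norm_nonneg b) hw]
      _ = (‖a‖ + ‖b‖) * max 1 ‖w‖ := by ring
      _ ≤ A * max 1 ‖w‖ := by gcongr; exact le_max_right _ _
  calc A * S * max 1 ‖(affineIterate a b f n).eval z‖ ≤ A * S * (A * max 1 ‖w‖) := by gcongr
    _ = A ^ 2 * (S * max 1 ‖w‖) := by ring
    _ ≤ A ^ d ^ n * (S * max 1 ‖z‖) ^ d ^ n := by
        gcongr
        exacts [hd.trans (Nat.le_self_pow hn d), hS.iterate_le_pow z n]
    _ = (A * S * max 1 ‖z‖) ^ d ^ n := by rw [← mul_pow, mul_assoc]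

theorem exists_forall_norm_eval_affineIterate_le (hx : x ∈ filledJuliaSet f) (a b : ℂ) :
    ∃ C, ∀ n, ‖(affineIterate a b f n).eval x‖ ≤ C := by
  obtain ⟨B, hB⟩ := isBounded_iff_forall_norm_le.1 (mem_filledJuliaSet_iff_isBounded.1 hx)
  refine ⟨‖a‖ * B + ‖b‖, fun n => ?_⟩
  rw [eval_affineIterate]
  exact (norm_add_le _ _).trans (by rw [norm_mul]; gcongr; exact hB _ ⟨n, rfl⟩)

theorem tendsto_norm_eval_affineIterate_atTop (ha : a ≠ 0) (b : ℂ) (hf : 2 ≤ f.natDegree)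
    (hx : x ∉ filledJuliaSet f) :
    Tendsto (fun q : ℕ × ℂ => ‖(affineIterate a b f q.1).eval q.2‖) (atTop ×ˢ 𝓝 x) atTop := by
  obtain ⟨s, hs⟩ := exists_isEscapeScale_eval hf
  simp only [eval_affineIterate]
  exact tendsto_norm_cobounded_atTop.comp ((tendsto_add_const_cobounded b).comp
    ((tendsto_mul_left_cobounded ha).comp (hs.tendsto_iterate_cobounded hx)))

theorem exists_eventually_filledJuliaSet_affineIterate_subset_closedBall (ha : a ≠ 0) (b : ℂ)
    (hf : 2 ≤ f.natDegree) :
    ∃ R, ∀ᶠ n in atTop, filledJuliaSet (affineIterate a b f n) ⊆ closedBall 0 R := by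
  obtain ⟨s, hs⟩ := exists_isEscapeScale_eval hf
  exact ⟨_, (hs.eventually_affineIterate_eval ha b).mono fun n hn =>
    hn.filledJuliaSet_subset_closedBall⟩

theorem eventually_notMem_filledJuliaSet_affineIterate (ha : a ≠ 0) (b : ℂ)
    (hf : 2 ≤ f.natDegree) (hx : x ∉ filledJuliaSet f) :
    ∀ᶠ q : ℕ × ℂ in atTop ×ˢ 𝓝 x, q.2 ∉ filledJuliaSet (affineIterate a b f q.1) := by
  obtain ⟨R, hR⟩ := exists_eventually_filledJuliaSet_affineIterate_subset_closedBall ha b hf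
  filter_upwards [tendsto_fst.eventually hR,
    (tendsto_norm_eval_affineIterate_atTop ha b hf hx).eventually_gt_atTop R] with q hq hfar hqK
  exact hfar.not_ge (mem_closedBall_zero_iff.1 (hq (eval_mem_filledJuliaSet_iff.2 hqK)))

theorem eventually_ball_inter_juliaSet_affineIterate_nonempty (ha : a ≠ 0) (b : ℂ)
    (hf : 2 ≤ f.natDegree) (hx : x ∈ juliaSet f) {ε : ℝ} (hε : 0 < ε) :
    ∀ᶠ n in atTop, (ball x ε ∩ juliaSet (affineIterate a b f n)).Nonempty := by
  obtain ⟨s, hs⟩ := exists_isEscapeScale_eval hf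
  obtain ⟨S, hS⟩ := exists_isGrowthScale_eval hf
  obtain ⟨C, hC⟩ :=
    exists_forall_norm_eval_affineIterate_le (juliaSet_subset_filledJuliaSet hf hx) a b
  have houtside : ∃ᶠ y in 𝓝 x, y ∉ filledJuliaSet f :=
    mem_closure_iff_frequently.1 (frontier_subset_closure (frontier_compl (filledJuliaSet f) ▸ hx))
  exact eventually_ball_inter_juliaSet_nonempty (hs.eventually_affineIterate_eval ha b)
    ((eventually_ne_atTop 0).mono fun n hn => hS.affineIterate_eval hf hn a b) (.of_forall hC)
    (houtside.mono fun y hy => (tendsto_norm_eval_affineIterate_atTop ha b hf hy).comp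
      (tendsto_id.prodMk tendsto_const_nhds)) hε

end AffineIterate

section Limits

variable {S T : ℕ → Set ℂ} {x : ℂ}

theorem mem_setLiminf : x ∈ setLiminf S ↔
    ∃ z : ℕ → ℂ, (∀ n, 1 ≤ n → z n ∈ S n) ∧ Tendsto z atTop (𝓝 x) :=
  Iff.rfl

theorem mem_setLimsup : x ∈ setLimsup S ↔
    ∃ n : ℕ → ℕ, StrictMono n ∧ (∀ k, 1 ≤ n k) ∧
      ∃ z : ℕ → ℂ, (∀ k, z k ∈ S (n k)) ∧ Tendsto z atTop (𝓝 x) :=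
  Iff.rfl

theorem setLiminf_subset_setLimsup (S : ℕ → Set ℂ) : setLiminf S ⊆ setLimsup S := by
  intro x hx
  obtain ⟨z, hz, hlim⟩ := mem_setLiminf.1 hx
  exact mem_setLimsup.2 ⟨(· + 1), strictMono_id.add_const 1, Nat.succ_pos, (fun k => z (k + 1)),
    fun k => hz _ k.succ_pos, hlim.comp (tendsto_add_atTop_nat 1)⟩

theorem setLimsup_mono (h : ∀ n, 1 ≤ n → S n ⊆ T n) : setLimsup S ⊆ setLimsup T := by
  intro x hx
  obtain ⟨n, hn, hn1, z, hz, hlim⟩ := mem_setLimsup.1 hx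
  exact mem_setLimsup.2 ⟨n, hn, hn1, z, fun k => h _ (hn1 k) (hz k), hlim⟩

theorem notMem_setLimsup_of_eventually (h : ∀ᶠ q : ℕ × ℂ in atTop ×ˢ 𝓝 x, q.2 ∉ S q.1) :
    x ∉ setLimsup S := by
  intro hx
  obtain ⟨n, hn, -, z, hz, hlim⟩ := mem_setLimsup.1 hx
  obtain ⟨k, hk⟩ := ((hn.tendsto_atTop.prodMk hlim).eventually h).exists
  exact hk (hz k)

theorem mem_setLiminf_of_eventually (hne : ∀ n, 1 ≤ n → (S n).Nonempty)
    (h : ∀ ε > 0, ∀ᶠ n in atTop, (ball x ε ∩ S n).Nonempty) : x ∈ setLiminf S := by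
  have hnear : ∀ n : ℕ, ∃ y, 1 ≤ n → y ∈ S n ∧ dist x y < infDist x (S n) + 1 / (n + 1) := by
    intro n
    by_cases hn : 1 ≤ n
    · obtain ⟨y, hy, hxy⟩ := (infDist_lt_iff (hne n hn)).1
        (lt_add_of_pos_right (infDist x (S n)) (Nat.one_div_pos_of_nat (n := n)))
      exact ⟨y, fun _ => ⟨hy, hxy⟩⟩
    · exact ⟨x, fun h => absurd h hn⟩
  choose z hz using hnear
  have hinfDist : Tendsto (fun n => infDist x (S n)) atTop (𝓝 0) := by
    refine tendsto_order.2 ⟨fun c hc => .of_forall fun n => hc.trans_le infDist_nonneg,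
      fun ε hε => (h ε hε).mono ?_⟩
    rintro n ⟨y, hyx, hy⟩
    exact (infDist_le_dist_of_mem hy).trans_lt (dist_comm y x ▸ hyx)
  refine mem_setLiminf.2 ⟨z, fun n hn => (hz n hn).1, tendsto_iff_dist_tendsto_zero.2 ?_⟩
  refine squeeze_zero' (.of_forall fun n => dist_nonneg)
    ((eventually_ge_atTop 1).mono fun n hn => dist_comm x (z n) ▸ (hz n hn).2.le) ?_
  simpa only [add_zero] using hinfDist.add tendsto_one_div_add_atTop_nhds_zero_nat

end Limits

section HausdorffConvergence

variable {ι α : Type*} [PseudoMetricSpace α] {l : Filter ι} {S : ι → Set α} {K L : Set α} {δ : ℝ}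

theorem eventually_subset_thickening (hK : IsCompact K) (hS : ∀ᶠ n in l, S n ⊆ K)
    (hL : ∀ x ∉ L, ∀ᶠ q : ι × α in l ×ˢ 𝓝 x, q.2 ∉ S q.1) (hδ : 0 < δ) :
    ∀ᶠ n in l, S n ⊆ thickening δ L := by
  have hescape : ∀ᶠ n in l, ∀ z ∈ K \ thickening δ L, z ∉ S n :=
    eventually_forall_mem_of_isCompact (hK.diff isOpen_thickening) fun x hx =>
      hL x fun hxL => hx.2 (self_subset_thickening hδ L hxL)
  filter_upwards [hescape, hS] with n hn hSn z hz
  by_contra hfar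
  exact hn z ⟨hSn hz, hfar⟩ hz

theorem eventually_subset_thickening_of_ball_inter_nonempty (hL : IsCompact L)
    (hmeet : ∀ x ∈ L, ∀ ε > 0, ∀ᶠ n in l, (ball x ε ∩ S n).Nonempty) (hδ : 0 < δ) :
    ∀ᶠ n in l, L ⊆ thickening δ (S n) := by
  refine eventually_forall_mem_of_isCompact hL fun x hx => ?_
  filter_upwards [(hmeet x hx (δ / 2) (half_pos hδ)).prod_mk (ball_mem_nhds x (half_pos hδ))]
  rintro ⟨n, z⟩ ⟨⟨y, hyx, hy⟩, hzx⟩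
  refine mem_thickening_iff.2 ⟨y, hy, ?_⟩
  calc dist z y ≤ dist z x + dist y x := dist_triangle_right z y x
    _ < δ / 2 + δ / 2 := add_lt_add hzx hyx
    _ = δ := add_halves δ

theorem tendsto_hausdorffEDist_zero_of_subset_thickening
    (hSL : ∀ δ > 0, ∀ᶠ n in l, S n ⊆ thickening δ L)
    (hLS : ∀ δ > 0, ∀ᶠ n in l, L ⊆ thickening δ (S n)) :
    Tendsto (fun n => hausdorffEDist (S n) L) l (𝓝 0) := by
  refine ENNReal.tendsto_nhds_zero.2 fun ε hε => ?_
  obtain ⟨δ, hδ, hδε⟩ := ENNReal.lt_iff_exists_nnreal_btwn.1 hε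
  filter_upwards [hSL δ (by exact_mod_cast hδ), hLS δ (by exact_mod_cast hδ)] with n hSn hLn
  rw [← ENNReal.ofReal_coe_nnreal] at hδε
  exact (hausdorffEDist_le_of_infEDist (fun z hz => (hSn hz).le) fun z hz => (hLn hz).le).trans
    hδε.le

end HausdorffConvergence

theorem tendstoHausdorff_juliaSet_affineIterate {a : ℂ} (ha : a ≠ 0) (b : ℂ) {f : ℂ[X]}
    (hf : 2 ≤ f.natDegree) (hJK : juliaSet f = filledJuliaSet f) :
    TendstoHausdorff (fun n => juliaSet (affineIterate a b f n)) (juliaSet f) := by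
  have hdeg : ∀ n, 1 ≤ n → 2 ≤ (affineIterate a b f n).natDegree := fun n hn =>
    two_le_natDegree_affineIterate ha b hf (Nat.one_le_iff_ne_zero.1 hn)
  obtain ⟨R, hR⟩ := exists_eventually_filledJuliaSet_affineIterate_subset_closedBall ha b hf
  refine ⟨fun n hn => ⟨juliaSet_nonempty (hdeg n hn), isCompact_juliaSet (hdeg n hn)⟩,
    juliaSet_nonempty hf, isCompact_juliaSet hf,
    tendsto_hausdorffEDist_zero_of_subset_thickening (fun δ hδ => ?_) fun δ =>
      eventually_subset_thickening_of_ball_inter_nonempty (isCompact_juliaSet hf) fun x hx ε =>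
        eventually_ball_inter_juliaSet_affineIterate_nonempty ha b hf hx⟩
  have hthick : ∀ᶠ n in atTop, filledJuliaSet (affineIterate a b f n) ⊆ thickening δ (juliaSet f) :=
    eventually_subset_thickening (isCompact_closedBall 0 R) hR
      (fun x hx => eventually_notMem_filledJuliaSet_affineIterate ha b hf (hJK ▸ hx)) hδ
  filter_upwards [hthick, eventually_ge_atTop 1] with n hn hn1
  exact (juliaSet_subset_filledJuliaSet (hdeg n hn1)).trans hn

theorem mainTheorem5_general (f : ℂ[X]) (hdeg : 2 ≤ f.natDegree) (a b : ℂ) (ha : a ≠ 0) :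
    (juliaSet f ⊆ setLiminf (fun n => juliaSet (affineIterate a b f n)) ∧
      setLiminf (fun n => juliaSet (affineIterate a b f n)) ⊆
        setLimsup (fun n => filledJuliaSet (affineIterate a b f n)) ∧
      setLimsup (fun n => filledJuliaSet (affineIterate a b f n)) ⊆ filledJuliaSet f) ∧
    (juliaSet f = filledJuliaSet f →
      setLiminf (fun n => juliaSet (affineIterate a b f n)) = juliaSet f ∧
      setLimsup (fun n => juliaSet (affineIterate a b f n)) = juliaSet f ∧
      TendstoHausdorff (fun n => juliaSet (affineIterate a b f n)) (juliaSet f)) := by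
  set J := fun n => juliaSet (affineIterate a b f n)
  set K := fun n => filledJuliaSet (affineIterate a b f n)
  have hdegP : ∀ n, 1 ≤ n → 2 ≤ (affineIterate a b f n).natDegree := fun n hn =>
    two_le_natDegree_affineIterate ha b hdeg (Nat.one_le_iff_ne_zero.1 hn)
  have hJK : ∀ n, 1 ≤ n → J n ⊆ K n := fun n hn => juliaSet_subset_filledJuliaSet (hdegP n hn)
  have hlower : juliaSet f ⊆ setLiminf J := fun x hx =>
    mem_setLiminf_of_eventually (fun n hn => juliaSet_nonempty (hdegP n hn)) fun ε =>
      eventually_ball_inter_juliaSet_affineIterate_nonempty ha b hdeg hx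
  have hupper : setLimsup K ⊆ filledJuliaSet f := fun x => not_imp_not.1 fun hx =>
    notMem_setLimsup_of_eventually (eventually_notMem_filledJuliaSet_affineIterate ha b hdeg hx)
  have hinf : setLiminf J ⊆ setLimsup J := setLiminf_subset_setLimsup J
  have hsup : setLimsup J ⊆ setLimsup K := setLimsup_mono hJK
  refine ⟨⟨hlower, hinf.trans hsup, hupper⟩, fun heq => ?_⟩
  have hupperJ : setLimsup J ⊆ juliaSet f := heq ▸ hsup.trans hupper
  exact ⟨(hinf.trans hupperJ).antisymm hlower, hupperJ.antisymm (hlower.trans hinf),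
    tendstoHausdorff_juliaSet_affineIterate ha b hdeg heq⟩

theorem mainTheorem5 (f : Polynomial ℂ) (hmonic : f.Monic) (hdeg : 2 ≤ f.natDegree)
    (hcentered : f.coeff (f.natDegree - 1) = 0) (a b : ℂ) (ha : a ≠ 0) :
    (juliaSet f ⊆ setLiminf (fun n => juliaSet (affineIterate a b f n)) ∧
      setLiminf (fun n => juliaSet (affineIterate a b f n)) ⊆
        setLimsup (fun n => filledJuliaSet (affineIterate a b f n)) ∧
      setLimsup (fun n => filledJuliaSet (affineIterate a b f n)) ⊆ filledJuliaSet f) ∧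
    (juliaSet f = filledJuliaSet f →
      setLiminf (fun n => juliaSet (affineIterate a b f n)) = juliaSet f ∧
      setLimsup (fun n => juliaSet (affineIterate a b f n)) = juliaSet f ∧
      TendstoHausdorff (fun n => juliaSet (affineIterate a b f n)) (juliaSet f)) :=
  mainTheorem5_general f hdeg a b ha
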